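/- Let $\mathbb N=\{1,2,3,\dots\}$ and let $\mathbb N^2$ carry the coordinatewise multiplication. Let $\omega:\mathbb N^2\to[1,\infty)$ be a Beurling–Domar (non-quasianalytic) weight, i.e. $\omega(m_1m_2,n_1n_2)\le\omega(m_1,n_1)\,\omega(m_2,n_2)$ for all $(m_1,n_1),(m_2,n_2)\in\mathbb N^2$ and $\sum_{n\in\mathbb N}\frac{\log\omega(l^n,k^n)}{1+n^2}<\infty$ for all $(l,k)\in\mathbb N^2$. Let $\mathbb H=\{z\in\mathbb C:\operatorname{Re}z\ge 0\}$, and let $\mathbf A_\omega$ be the unital commutative algebra, under pointwise operations, of all functions $\widetilde a:\mathbb H^2\to\mathbb C$ having an $\omega$-absolutely convergent Dirichlet series, i.e. for which there are coefficients $a(m,n)\in\mathbb C$ with $\sum_{(m,n)\in\mathbb N^2}|a(m,n)|\,\omega(m,n)<\infty$ and $\widetilde a(s_1,s_2)=\sum_{(m,n)\in\mathbb N^2}a(m,n)\,m^{-s_1}n^{-s_2}$ for all $(s_1,s_2)\in\mathbb H^2$. Let $\widetilde a\in\mathbf A_\omega$. Then $\widetilde a$ has an inverse in $\mathbf A_\omega$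 if and only if $\widetilde a$ is bounded away from zero, i.e. there is $\delta>0$ such that $|\widetilde a(s_1,s_2)|\ge\delta$ for all $(s_1,s_2)\in\mathbb H^2$. -/

import Mathlib

/-- The closed right half plane `{z : ℂ | 0 ≤ Re z}`. -/
abbrev ClosedRightHalfPlane : Type := {z : ℂ // 0 ≤ z.re}

/-- A weight on the multiplicative semigroup `ℕ²` (positive integers, coordinatewise product):
a submultiplicative function with values in `[1, ∞)`. -/
structure IsWeight (ω : ℕ+ × ℕ+ → ℝ) : Prop where
  one_le : ∀ x, 1 ≤ ω x
  mul_le : ∀ x y, ω (x * y) ≤ ω x * ω y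

/-- A Beurling-Domar (non-quasianalytic) weight on `ℕ²`. Here `x ^ n = (l ^ n, k ^ n)` for
`x = (l, k)`. -/
structure IsBeurlingDomarWeight (ω : ℕ+ × ℕ+ → ℝ) : Prop extends IsWeight ω where
  summable_log : ∀ x : ℕ+ × ℕ+,
    Summable fun n : ℕ+ => Real.log (ω (x ^ (n : ℕ))) / (1 + (n : ℝ) ^ 2)

/-- The Dirichlet monomial `m ^ (-s₁) * n ^ (-s₂)`. -/
noncomputable def dirichletMonomial (x : ℕ+ × ℕ+)
    (s : ClosedRightHalfPlane × ClosedRightHalfPlane) : ℂ :=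
  ((x.1 : ℕ) : ℂ) ^ (-(s.1 : ℂ)) * ((x.2 : ℕ) : ℂ) ^ (-(s.2 : ℂ))

/-- `f` has an `ω`-absolutely convergent Dirichlet series on the product of two closed
right half planes. -/
def HasWeightedDirichletSeries (ω : ℕ+ × ℕ+ → ℝ)
    (f : ClosedRightHalfPlane × ClosedRightHalfPlane → ℂ) : Prop :=
  ∃ a : ℕ+ × ℕ+ → ℂ, (Summable fun x => ‖a x‖ * ω x) ∧
    ∀ s, HasSum (fun x => a x * dirichletMonomial x s) (f s)

theorem dirichletMonomial_mul (x y : ℕ+ × ℕ+)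
    (s : ClosedRightHalfPlane × ClosedRightHalfPlane) :
    dirichletMonomial (x * y) s = dirichletMonomial x s * dirichletMonomial y s := by
  simp only [dirichletMonomial, Prod.fst_mul, Prod.snd_mul, PNat.mul_coe, Nat.cast_mul,
    Complex.natCast_mul_natCast_cpow]
  ring

theorem dirichletMonomial_one (s : ClosedRightHalfPlane × ClosedRightHalfPlane) :
    dirichletMonomial 1 s = 1 := by
  simp [dirichletMonomial]

theorem norm_dirichletMonomial_le (x : ℕ+ × ℕ+)
    (s : ClosedRightHalfPlane × ClosedRightHalfPlane) : ‖dirichletMonomial x s‖ ≤ 1 := by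
  have h : ∀ (m : ℕ+) (z : ClosedRightHalfPlane), ‖((m : ℕ) : ℂ) ^ (-(z : ℂ))‖ ≤ 1 := by
    intro m z
    rw [Complex.norm_natCast_cpow_of_pos m.pos]
    exact Real.rpow_le_one_of_one_le_of_nonpos (by exact_mod_cast m.pos)
      (by simpa using z.2)
  rw [dirichletMonomial, norm_mul]
  exact mul_le_one₀ (h _ _) (norm_nonneg _) (h _ _)

theorem HasWeightedDirichletSeries.const (ω : ℕ+ × ℕ+ → ℝ) (c : ℂ) :
    HasWeightedDirichletSeries ω fun _ => c := by
  classical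
  refine ⟨Pi.single 1 c, ?_, fun s => ?_⟩
  · refine summable_of_ne_finset_zero (s := {1}) fun x hx => ?_
    simp [Pi.single_eq_of_ne (by simpa using hx : x ≠ 1)]
  · have := hasSum_single (f := fun x => (Pi.single 1 c : ℕ+ × ℕ+ → ℂ) x * dirichletMonomial x s)
      1 (fun x hx => by simp [Pi.single_eq_of_ne hx])
    simpa [dirichletMonomial_one] using this

theorem HasWeightedDirichletSeries.add {ω : ℕ+ × ℕ+ → ℝ} (hω : IsWeight ω)
    {f g : ClosedRightHalfPlane × ClosedRightHalfPlane → ℂ}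
    (hf : HasWeightedDirichletSeries ω f) (hg : HasWeightedDirichletSeries ω g) :
    HasWeightedDirichletSeries ω (f + g) := by
  obtain ⟨a, ha, ha'⟩ := hf
  obtain ⟨b, hb, hb'⟩ := hg
  refine ⟨a + b, ?_, fun s => ?_⟩
  · refine Summable.of_nonneg_of_le (fun x => ?_) (fun x => ?_) (ha.add hb)
    · exact mul_nonneg (norm_nonneg _) (zero_le_one.trans (hω.one_le x))
    · rw [← add_mul]
      exact mul_le_mul_of_nonneg_right (norm_add_le _ _) (zero_le_one.trans (hω.one_le x))
  · simpa [add_mul] using (ha' s).add (hb' s)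

theorem HasWeightedDirichletSeries.mul {ω : ℕ+ × ℕ+ → ℝ} (hω : IsWeight ω)
    {f g : ClosedRightHalfPlane × ClosedRightHalfPlane → ℂ}
    (hf : HasWeightedDirichletSeries ω f) (hg : HasWeightedDirichletSeries ω g) :
    HasWeightedDirichletSeries ω (f * g) := by
  obtain ⟨a, ha, ha'⟩ := hf
  obtain ⟨b, hb, hb'⟩ := hg
  have h0 : ∀ x, 0 ≤ ω x := fun x => zero_le_one.trans (hω.one_le x)
  let e := Equiv.sigmaFiberEquiv fun q : (ℕ+ × ℕ+) × (ℕ+ × ℕ+) => q.1 * q.2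
  let F : (ℕ+ × ℕ+) × (ℕ+ × ℕ+) → ℂ := fun q => a q.1 * b q.2
  have hW : Summable fun q : (ℕ+ × ℕ+) × (ℕ+ × ℕ+) => ‖F q‖ * ω (q.1 * q.2) := by
    refine Summable.of_nonneg_of_le (fun q => mul_nonneg (norm_nonneg _) (h0 _)) (fun q => ?_)
      (ha.mul_of_nonneg hb (fun x => mul_nonneg (norm_nonneg _) (h0 _))
        (fun x => mul_nonneg (norm_nonneg _) (h0 _)))
    calc ‖F q‖ * ω (q.1 * q.2) ≤ ‖F q‖ * (ω q.1 * ω q.2) :=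
          mul_le_mul_of_nonneg_left (hω.mul_le _ _) (norm_nonneg _)
      _ = _ := by simp only [F, norm_mul]; ring
  have hN : Summable fun q => ‖F q‖ :=
    Summable.of_nonneg_of_le (fun q => norm_nonneg _)
      (fun q => le_mul_of_one_le_right (norm_nonneg _) (hω.one_le _)) hW
  have he : ∀ p, (e p).1 * (e p).2 = p.1 := fun p => p.2.2
  have hNe : Summable fun p => ‖F (e p)‖ := e.summable_iff.mpr hN
  have hWe : Summable fun p => ‖F (e p)‖ * ω p.1 := by
    have := e.summable_iff.mpr hW
    refine this.congr fun p => ?_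
    simp only [Function.comp, he]
  refine ⟨fun z => ∑' q, F (e ⟨z, q⟩), ?_, fun s => ?_⟩
  · refine Summable.of_nonneg_of_le (fun z => mul_nonneg (norm_nonneg _) (h0 _)) (fun z => ?_)
      hWe.sigma
    beta_reduce
    dsimp only
    rw [tsum_mul_right]
    exact mul_le_mul_of_nonneg_right (norm_tsum_le_tsum_norm (hNe.sigma_factor z)) (h0 _)
  · have hG : Summable fun q : (ℕ+ × ℕ+) × (ℕ+ × ℕ+) =>
        (a q.1 * dirichletMonomial q.1 s) * (b q.2 * dirichletMonomial q.2 s) := by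
      refine Summable.of_norm_bounded hN fun q => ?_
      have : (a q.1 * dirichletMonomial q.1 s) * (b q.2 * dirichletMonomial q.2 s)
          = F q * dirichletMonomial (q.1 * q.2) s := by
        rw [dirichletMonomial_mul]; simp only [F]; ring
      rw [this, norm_mul]
      exact mul_le_of_le_one_right (norm_nonneg _) (norm_dirichletMonomial_le _ _)
    have hP := e.hasSum_iff.mpr ((ha' s).mul (hb' s) hG)
    have hP' : HasSum (fun p => F (e p) * dirichletMonomial p.1 s) (f s * g s) := by
      have hE : (fun p => F (e p) * dirichletMonomial p.1 s) =
          (fun q : (ℕ+ × ℕ+) × (ℕ+ × ℕ+) =>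
            (a q.1 * dirichletMonomial q.1 s) * (b q.2 * dirichletMonomial q.2 s)) ∘ e := by
        funext p
        simp only [Function.comp]
        rw [← he p, dirichletMonomial_mul]
        simp only [F]
        ring
      rw [hE]
      exact hP
    refine hP'.sigma fun z => ?_
    exact ((hNe.of_norm).sigma_factor z).hasSum.mul_right (dirichletMonomial z s)

/-- The algebra `A_ω` of all functions on the product of two closed right half planes having an
`ω`-absolutely convergent Dirichlet series, with the usual (pointwise) operations. -/
def weightedDirichletAlgebra (ω : ℕ+ × ℕ+ → ℝ) (hω : IsWeight ω) :
    Subalgebra ℂ (ClosedRightHalfPlane × ClosedRightHalfPlane → ℂ) where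
  carrier := {f | HasWeightedDirichletSeries ω f}
  mul_mem' := HasWeightedDirichletSeries.mul hω
  add_mem' := HasWeightedDirichletSeries.add hω
  algebraMap_mem' := HasWeightedDirichletSeries.const ω

/-! If `f` has an inverse `g` in the algebra, `|g|` is at most the weighted norm `C` of its
coefficients, so `|f| ≥ 1/C`.

The converse is a Newman-type argument. Truncate the series of `f` to a Dirichlet polynomial `P`
with `‖P - f‖ ≤ δ/4`, so that `|P| ≥ 3δ/4`, and expand `1/f = ∑ (P - f)^n P^(-(n+1))`. This
converges in the weighted norm as soon as `‖P^(-N)‖ ≤ K (2/δ)^N` with `K` independent of `N`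
(`IsBeurlingDomarWeight.exists_inv_pow`).

For that bound, restrict to a line `(s, l s)` with `l` chosen so that the frequencies `Λ = log m + l
log n` are distinct. The resulting exponential polynomial `p` keeps the lower bound `δ/2` on some
half plane `Re s ≥ -ε` (`exists_shift_lower_bound`). Far to the right `p^(-N)` is a Dirichlet series
by a Neumann expansion (`exists_coeff_inv_pow`), and shifting the line of integration to `Re s = -ε`
gives `|b x| ≤ (2/δ)^N exp(-ε Λ x)` (`norm_dirichletSeries_coeff_le`). The support lies in a
finitely generated semigroup, on which `ω x * exp(-ε Λ x)` is summable because a Beurling–Domar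
weight grows subexponentially along powers. Uniqueness of coefficients carries the identity `P^N
P^(-N) = 1` from the line to all points. -/

/-! ### Weighted absolutely convergent series over a monoid -/

/-- `f` is the sum of the series `∑ a x * χ x` for coefficients `a` whose `ω`-weighted
`ℓ¹`-norm is at most `C`. -/
def HasSeriesNormLE {M D : Type*} (χ : M → D → ℂ) (ω : M → ℝ) (f : D → ℂ) (C : ℝ) : Prop :=
  ∃ a : M → ℂ, (Summable fun x => ‖a x‖ * ω x) ∧ ∑' x, ‖a x‖ * ω x ≤ C ∧
    ∀ s, HasSum (fun x => a x * χ x s) (f s)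

/-- A family of characters of the monoid `M`, dominated by the submultiplicative weight `ω`. -/
structure IsWeightedCharacterFamily {M D : Type*} [Monoid M] (χ : M → D → ℂ) (ω : M → ℝ) :
    Prop where
  map_one : ∀ s, χ 1 s = 1
  map_mul : ∀ x y s, χ (x * y) s = χ x s * χ y s
  norm_le : ∀ x s, ‖χ x s‖ ≤ ω x
  weight_pos : ∀ x, 0 < ω x
  weight_mul_le : ∀ x y, ω (x * y) ≤ ω x * ω y

namespace HasSeriesNormLE

variable {M D : Type*} {χ : M → D → ℂ} {ω : M → ℝ}

theorem congr {f g : D → ℂ} {C : ℝ} (hf : HasSeriesNormLE χ ω f C) (h : ∀ s, f s = g s) :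
    HasSeriesNormLE χ ω g C := by
  rwa [← funext h]

theorem finset_sum (S : Finset M) (a : M → ℂ) :
    HasSeriesNormLE χ ω (fun s => ∑ x ∈ S, a x * χ x s) (∑ x ∈ S, ‖a x‖ * ω x) := by
  classical
  refine ⟨fun x => if x ∈ S then a x else 0, ?_, ?_, fun s => ?_⟩
  · exact summable_of_ne_finset_zero (s := S) fun x hx => by simp [hx]
  · rw [tsum_eq_sum (s := S) fun x hx => by simp [hx]]
    exact (Finset.sum_congr rfl fun x hx => by simp [hx]).le
  · have : HasSum (fun x => (if x ∈ S then a x else 0) * χ x s)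
        (∑ x ∈ S, (if x ∈ S then a x else 0) * χ x s) :=
      hasSum_sum_of_ne_finset_zero fun x hx => by simp [hx]
    convert this using 1
    exact Finset.sum_congr rfl fun x hx => by simp [hx]

/-- Extension of the coefficients by zero; it brings series over a submonoid back to the whole
monoid. -/
theorem of_injective {M' : Type*} {φ : M' → M} (hφ : Function.Injective φ) {f : D → ℂ} {C : ℝ}
    (hf : HasSeriesNormLE (fun x => χ (φ x)) (fun x => ω (φ x)) f C) :
    HasSeriesNormLE χ ω f C := by
  obtain ⟨a, ha, hC, hs⟩ := hf
  have h0 : ∀ x ∉ Set.range φ, Function.extend φ a 0 x = 0 := fun x hx => by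
    rw [Function.extend_apply' _ _ _ (by simpa using hx)]; rfl
  have h1 : (fun x => ‖Function.extend φ a 0 x‖ * ω x) ∘ φ = fun x => ‖a x‖ * ω (φ x) := by
    funext x; simp [hφ.extend_apply]
  refine ⟨Function.extend φ a 0, ?_, ?_, fun s => ?_⟩
  · rw [← hφ.summable_iff fun x hx => by simp [h0 x hx], h1]
    exact ha
  · refine le_of_eq_of_le ?_ hC
    rw [← hφ.tsum_eq (f := fun x => ‖Function.extend φ a 0 x‖ * ω x)]
    · exact tsum_congr fun x => by simp [hφ.extend_apply]
    · intro x hx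
      by_contra h
      exact hx (by simp [h0 x h])
  · rw [← hφ.hasSum_iff fun x hx => by simp [h0 x hx]]
    convert hs s using 2 with x
    simp [hφ.extend_apply]

section Monoid

variable [Monoid M] (h : IsWeightedCharacterFamily χ ω)
include h

theorem norm_apply_le {f : D → ℂ} {C : ℝ} (hf : HasSeriesNormLE χ ω f C) (s : D) :
    ‖f s‖ ≤ C := by
  obtain ⟨a, ha, hC, hs⟩ := hf
  rw [← (hs s).tsum_eq]
  refine (tsum_of_norm_bounded ha.hasSum fun x => ?_).trans hC
  rw [norm_mul]
  exact mul_le_mul_of_nonneg_left (h.norm_le x s) (norm_nonneg _)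

/-- Group the pairs of indices by their product. The fibres may be infinite; convergence on the
fibre over `z` follows from the weighted sum since `ω z > 0`. -/
theorem mul {f g : D → ℂ} {A B : ℝ} (hf : HasSeriesNormLE χ ω f A)
    (hg : HasSeriesNormLE χ ω g B) : HasSeriesNormLE χ ω (f * g) (A * B) := by
  obtain ⟨a, ha, hA, ha'⟩ := hf
  obtain ⟨b, hb, hB, hb'⟩ := hg
  have h0 : ∀ x, 0 ≤ ω x := fun x => (h.weight_pos x).le
  have ha0 : ∀ x, 0 ≤ ‖a x‖ * ω x := fun x => mul_nonneg (norm_nonneg _) (h0 x)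
  have hb0 : ∀ x, 0 ≤ ‖b x‖ * ω x := fun x => mul_nonneg (norm_nonneg _) (h0 x)
  let e := Equiv.sigmaFiberEquiv fun q : M × M => q.1 * q.2
  let F : M × M → ℂ := fun q => a q.1 * b q.2
  have hle : ∀ q : M × M, ‖F q‖ * ω (q.1 * q.2) ≤ (‖a q.1‖ * ω q.1) * (‖b q.2‖ * ω q.2) :=
    fun q => calc ‖F q‖ * ω (q.1 * q.2) ≤ ‖F q‖ * (ω q.1 * ω q.2) :=
          mul_le_mul_of_nonneg_left (h.weight_mul_le _ _) (norm_nonneg _)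
      _ = _ := by simp only [F, norm_mul]; ring
  have hab := ha.mul_of_nonneg hb ha0 hb0
  have hW : Summable fun q : M × M => ‖F q‖ * ω (q.1 * q.2) :=
    Summable.of_nonneg_of_le (fun q => mul_nonneg (norm_nonneg _) (h0 _)) hle hab
  have hWC : ∑' q : M × M, ‖F q‖ * ω (q.1 * q.2) ≤ A * B := by
    refine (hW.tsum_le_tsum hle hab).trans ?_
    rw [← ha.tsum_mul_tsum hb hab]
    exact mul_le_mul hA hB (tsum_nonneg hb0) ((tsum_nonneg ha0).trans hA)
  have he : ∀ p, (e p).1 * (e p).2 = p.1 := fun p => p.2.2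
  have hWe : HasSum (fun p => ‖F (e p)‖ * ω p.1) (∑' q : M × M, ‖F q‖ * ω (q.1 * q.2)) := by
    have := e.hasSum_iff.mpr hW.hasSum
    convert this using 2 with p
    rw [Function.comp_apply, he]
  have hN : ∀ z, Summable fun q => ‖F (e ⟨z, q⟩)‖ := fun z => by
    have := hWe.summable.sigma_factor z
    exact (summable_mul_right_iff (h.weight_pos z).ne').mp this
  have hb1 : ∀ z, ‖∑' q, F (e ⟨z, q⟩)‖ * ω z ≤ ∑' q, ‖F (e ⟨z, q⟩)‖ * ω z := fun z => by
    rw [tsum_mul_right]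
    exact mul_le_mul_of_nonneg_right (norm_tsum_le_tsum_norm (hN z)) (h0 _)
  have hS := Summable.of_nonneg_of_le (fun z => mul_nonneg (norm_nonneg _) (h0 _)) hb1
    hWe.summable.sigma
  refine ⟨fun z => ∑' q, F (e ⟨z, q⟩), hS, ?_, fun s => ?_⟩
  · refine (hS.tsum_le_tsum hb1 hWe.summable.sigma).trans (le_of_eq_of_le ?_ hWC)
    rw [← hWe.tsum_eq]
    exact hWe.summable.tsum_sigma.symm
  · have hG : Summable fun q : M × M => (a q.1 * χ q.1 s) * (b q.2 * χ q.2 s) := by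
      refine Summable.of_norm_bounded hW fun q => ?_
      have : (a q.1 * χ q.1 s) * (b q.2 * χ q.2 s) = F q * χ (q.1 * q.2) s := by
        rw [h.map_mul]; simp only [F]; ring
      rw [this, norm_mul]
      exact mul_le_mul_of_nonneg_left (h.norm_le _ _) (norm_nonneg _)
    have hP := e.hasSum_iff.mpr ((ha' s).mul (hb' s) hG)
    have hP' : HasSum (fun p => F (e p) * χ p.1 s) (f s * g s) := by
      refine hP.congr_fun fun p => ?_
      rw [Function.comp_apply, ← he p, h.map_mul]
      simp only [F]
      ring
    exact hP'.sigma fun z => (hN z).of_norm.hasSum.mul_right (χ z s)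

theorem pow_mul {f g : D → ℂ} {A B : ℝ} (hf : HasSeriesNormLE χ ω f A)
    (hg : HasSeriesNormLE χ ω g B) (n : ℕ) : HasSeriesNormLE χ ω (f ^ n * g) (A ^ n * B) := by
  induction n with
  | zero => simpa using hg
  | succ n ih =>
    rw [pow_succ', pow_succ', mul_assoc, mul_assoc]
    exact mul h hf ih

theorem one : HasSeriesNormLE χ ω (fun _ => 1) (ω 1) := by
  have := finset_sum (χ := χ) (ω := ω) {1} fun _ => 1
  simpa [h.map_one] using this

/-- This plays the role of completeness: a norm-convergent series of functions may be summed
coefficientwise, by Tonelli. It serves both geometric expansions below. -/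
theorem hasSum {f : ℕ → D → ℂ} {C : ℕ → ℝ} {g : D → ℂ} (hf : ∀ n, HasSeriesNormLE χ ω (f n) (C n))
    (hC : Summable C) (hg : ∀ s, HasSum (fun n => f n s) (g s)) :
    HasSeriesNormLE χ ω g (∑' n, C n) := by
  choose a ha haC hs using hf
  have h0 : ∀ n x, 0 ≤ ‖a n x‖ * ω x :=
    fun n x => mul_nonneg (norm_nonneg _) (h.weight_pos x).le
  have hN : Summable fun n => ∑' x, ‖a n x‖ * ω x :=
    Summable.of_nonneg_of_le (fun n => tsum_nonneg (h0 n)) haC hC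
  have hF : Summable fun q : ℕ × M => ‖a q.1 q.2‖ * ω q.2 :=
    (summable_prod_of_nonneg fun q => h0 q.1 q.2).mpr ⟨ha, hN⟩
  have hF' : Summable fun q : M × ℕ => ‖a q.2 q.1‖ * ω q.1 := hF.prod_symm
  have hx : ∀ x, Summable fun n => ‖a n x‖ := fun x =>
    (summable_mul_right_iff (h.weight_pos x).ne').mp (hF'.prod_factor x)
  have hb : ∀ x, ‖∑' n, a n x‖ * ω x ≤ ∑' n, ‖a n x‖ * ω x := fun x => by
    rw [tsum_mul_right]
    exact mul_le_mul_of_nonneg_right (norm_tsum_le_tsum_norm (hx x)) (h.weight_pos x).le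
  have hS := Summable.of_nonneg_of_le
    (fun x => mul_nonneg (norm_nonneg _) (h.weight_pos x).le) hb hF'.prod
  refine ⟨fun x => ∑' n, a n x, hS, ?_, fun s => ?_⟩
  · refine (hS.tsum_le_tsum hb hF'.prod).trans (le_trans (le_of_eq ?_) (hN.tsum_le_tsum haC hC))
    exact Summable.tsum_comm (f := fun n x => ‖a n x‖ * ω x) hF
  · have hG : Summable fun q : ℕ × M => a q.1 q.2 * χ q.2 s := by
      refine Summable.of_norm_bounded hF fun q => ?_
      rw [norm_mul]
      exact mul_le_mul_of_nonneg_left (h.norm_le _ _) (norm_nonneg _)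
    have h1 := hG.hasSum.prod_fiberwise fun n => hs n s
    have h2 : HasSum (fun q : M × ℕ => a q.2 q.1 * χ q.1 s) (∑' q : ℕ × M, a q.1 q.2 * χ q.2 s) :=
      (Equiv.prodComm M ℕ).hasSum_iff.mpr hG.hasSum
    rw [(hg s).unique h1]
    exact h2.prod_fiberwise fun x => (hx x).of_norm.hasSum.mul_right (χ x s)

end Monoid

end HasSeriesNormLE
-- Mean values and coefficients of general Dirichlet series
open Filter Topology in
theorem tendsto_mean_exp_mul_I (d : ℝ) :
    Tendsto (fun T : ℝ => ((2 * T : ℝ) : ℂ)⁻¹ * ∫ t in -T..T, Complex.exp (d * Complex.I * t))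
      atTop (𝓝 (if d = 0 then 1 else 0)) := by
  split_ifs with hd
  · refine tendsto_const_nhds.congr' ?_
    filter_upwards [eventually_gt_atTop 0] with T hT
    have : (T : ℂ) ≠ 0 := by exact_mod_cast hT.ne'
    simp [hd]
    field_simp
    norm_num
  · have hc : (d : ℂ) * Complex.I ≠ 0 := by simp [hd]
    have hlim : Tendsto (fun T : ℝ => (2 * T)⁻¹ * (2 / |d|)) atTop (𝓝 0) := by
      have : Tendsto (fun T : ℝ => 2 * T) atTop atTop := tendsto_id.const_mul_atTop two_pos
      simpa using this.inv_tendsto_atTop.mul_const (2 / |d|)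
    refine squeeze_zero_norm' ?_ hlim
    filter_upwards [eventually_gt_atTop 0] with T hT
    rw [norm_mul, norm_inv, Complex.norm_real, Real.norm_of_nonneg (by positivity),
      integral_exp_mul_complex hc, norm_div]
    have hn : ∀ t : ℝ, ‖Complex.exp (d * Complex.I * t)‖ = 1 := fun t => by
      rw [Complex.norm_exp]; simp
    gcongr
    · refine (norm_sub_le _ _).trans ?_
      rw [hn, hn]; norm_num
    · simp

section

variable {M : Type*} [Countable M] {Λ : M → ℝ} {b : M → ℂ} {σ : ℝ} {q : ℂ → ℂ}

open Filter Topology in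
/-- The coefficients of an absolutely convergent general Dirichlet series are its mean values
on vertical lines. -/
theorem tendsto_mean_dirichletSeries (hΛ : Function.Injective Λ)
    (hb : Summable fun x => ‖b x‖ * Real.exp (-Λ x * σ))
    (hq : ∀ t : ℝ, HasSum (fun x => b x * Complex.exp (-Λ x * (σ + t * Complex.I)))
      (q (σ + t * Complex.I))) (y : M) :
    Tendsto (fun T : ℝ => ((2 * T : ℝ) : ℂ)⁻¹ *
      ∫ t in -T..T, q (σ + t * Complex.I) * Complex.exp (Λ y * (σ + t * Complex.I)))
      atTop (𝓝 (b y)) := by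
  classical
  -- On the line `Re s = σ` the moduli are absorbed into `g`, leaving unimodular oscillations of
  -- frequency `Λ y - Λ x`; only `x = y` has a nonzero mean.
  let g : M → ℂ := fun x => b x * Complex.exp (((Λ y - Λ x) * σ : ℝ) : ℂ)
  have hg : Summable fun x => ‖g x‖ := by
    refine (hb.mul_right (Real.exp (Λ y * σ))).congr fun x => ?_
    rw [norm_mul, Complex.norm_exp_ofReal, mul_assoc, ← Real.exp_add]
    congr 2; ring
  have he : ∀ x (t : ℝ), ‖Complex.exp (((Λ y - Λ x : ℝ) : ℂ) * Complex.I * t)‖ = 1 :=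
    fun x t => by rw [Complex.norm_exp]; simp
  have hsum : ∀ t : ℝ, HasSum
      (fun x => g x * Complex.exp (((Λ y - Λ x : ℝ) : ℂ) * Complex.I * t))
      (q (σ + t * Complex.I) * Complex.exp (Λ y * (σ + t * Complex.I))) := fun t => by
    refine ((hq t).mul_right (Complex.exp (Λ y * (σ + t * Complex.I)))).congr_fun fun x => ?_
    simp only [g]
    rw [mul_assoc (b x), mul_assoc (b x), ← Complex.exp_add, ← Complex.exp_add]
    congr 2; push_cast; ring
  have hint : ∀ T : ℝ, HasSum (fun x => g x *
      ∫ t in -T..T, Complex.exp (((Λ y - Λ x : ℝ) : ℂ) * Complex.I * t))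
      (∫ t in -T..T, q (σ + t * Complex.I) * Complex.exp (Λ y * (σ + t * Complex.I))) := fun T => by
    simp_rw [← intervalIntegral.integral_const_mul]
    refine intervalIntegral.hasSum_integral_of_dominated_convergence (fun x _ => ‖g x‖)
      (fun x => Continuous.aestronglyMeasurable (by fun_prop)) (fun x => ?_) ?_ ?_ ?_
    · exact Eventually.of_forall fun t _ => by rw [norm_mul, he, mul_one]
    · exact Eventually.of_forall fun t _ => hg
    · exact intervalIntegrable_const
    · exact Eventually.of_forall fun t _ => hsum t
  have hlim := tendsto_tsum_of_dominated_convergence (𝓕 := atTop) (bound := fun x => ‖g x‖)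
    (f := fun (T : ℝ) x => g x * (((2 * T : ℝ) : ℂ)⁻¹ *
      ∫ t in -T..T, Complex.exp (((Λ y - Λ x : ℝ) : ℂ) * Complex.I * t)))
    (g := fun x => g x * if Λ y - Λ x = 0 then 1 else 0) hg
    (fun x => (tendsto_mean_exp_mul_I _).const_mul _) ?_
  · have h1 : ∑' x, g x * (if Λ y - Λ x = 0 then (1 : ℂ) else 0) = b y := by
      rw [tsum_eq_single y]
      · simp [g]
      · intro x hx
        rw [if_neg (sub_ne_zero.mpr fun h => hx (hΛ h.symm)), mul_zero]
    rw [h1] at hlim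
    refine hlim.congr fun T => ?_
    rw [← ((hint T).mul_left _).tsum_eq]
    exact tsum_congr fun x => by ring
  · filter_upwards [eventually_gt_atTop 0] with T hT x
    rw [norm_mul]
    refine mul_le_of_le_one_right (norm_nonneg _) ?_
    rw [norm_mul, norm_inv, Complex.norm_real, Real.norm_of_nonneg (by positivity)]
    rw [inv_mul_le_one₀ (by positivity)]
    refine (intervalIntegral.norm_integral_le_of_norm_le_const (C := 1)
      fun t _ => (he x t).le).trans ?_
    rw [one_mul, abs_of_nonneg (by linarith)]
    linarith

theorem dirichletSeries_coeff_unique {b' : M → ℂ} (hΛ : Function.Injective Λ)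
    (hb : Summable fun x => ‖b x‖ * Real.exp (-Λ x * σ))
    (hb' : Summable fun x => ‖b' x‖ * Real.exp (-Λ x * σ))
    (hq : ∀ t : ℝ, HasSum (fun x => b x * Complex.exp (-Λ x * (σ + t * Complex.I)))
      (q (σ + t * Complex.I)))
    (hq' : ∀ t : ℝ, HasSum (fun x => b' x * Complex.exp (-Λ x * (σ + t * Complex.I)))
      (q (σ + t * Complex.I))) : b = b' :=
  funext fun y => tendsto_nhds_unique (tendsto_mean_dirichletSeries hΛ hb hq y)
    (tendsto_mean_dirichletSeries hΛ hb' hq' y)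

open Filter Topology in
/-- Cauchy's estimate for the coefficients of a general Dirichlet series which extends to a
bounded holomorphic function on the half plane `-ε ≤ Re s`. -/
theorem norm_dirichletSeries_coeff_le {ε B : ℝ} (hΛ : Function.Injective Λ) (hσ : -ε ≤ σ)
    (hb : Summable fun x => ‖b x‖ * Real.exp (-Λ x * σ))
    (hq : ∀ t : ℝ, HasSum (fun x => b x * Complex.exp (-Λ x * (σ + t * Complex.I)))
      (q (σ + t * Complex.I)))
    (hd : DifferentiableOn ℂ q {s | -ε ≤ s.re}) (hB : ∀ s : ℂ, -ε ≤ s.re → ‖q s‖ ≤ B) (y : M) :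
    ‖b y‖ ≤ B * Real.exp (-Λ y * ε) := by
  have hB0 : 0 ≤ B := (norm_nonneg _).trans (hB σ (by simpa using hσ))
  let G : ℂ → ℂ := fun s => q s * Complex.exp (Λ y * s)
  have hnorm : ∀ s : ℂ, ‖Complex.exp (Λ y * s)‖ = Real.exp (Λ y * s.re) := fun s => by
    rw [Complex.norm_exp]; simp
  have hG : DifferentiableOn ℂ G {s | -ε ≤ s.re} :=
    hd.mul (by fun_prop)
  -- A bound on the horizontal sides of the rectangle. It depends on `y` but not on `T`, so these
  -- sides vanish after division by `2 * T`.
  let A : ℝ := B * Real.exp (|Λ y| * (|ε| + |σ|))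
  have hle : ∀ T : ℝ, ∀ x ∈ Set.uIoc (-ε) σ, ‖G (x + T * Complex.I)‖ ≤ A := fun T x hx => by
    rw [Set.uIoc_of_le hσ] at hx
    simp only [G, A]
    rw [norm_mul, hnorm]
    refine mul_le_mul (hB _ (by simpa using hx.1.le)) ?_ (Real.exp_pos _).le hB0
    rw [Real.exp_le_exp]
    have h1 : |x| ≤ |ε| + |σ| := by
      rw [abs_le]
      constructor
      · linarith [le_abs_self ε, abs_nonneg σ, hx.1]
      · linarith [le_abs_self σ, abs_nonneg ε, hx.2]
    calc Λ y * ((x : ℂ) + T * Complex.I).re = Λ y * x := by simp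
      _ ≤ |Λ y * x| := le_abs_self _
      _ = |Λ y| * |x| := abs_mul _ _
      _ ≤ _ := mul_le_mul_of_nonneg_left h1 (abs_nonneg _)
  have key : ∀ T : ℝ, 0 < T → ‖((2 * T : ℝ) : ℂ)⁻¹ *
      ∫ t in -T..T, q (σ + t * Complex.I) * Complex.exp (Λ y * (σ + t * Complex.I))‖ ≤
      B * Real.exp (-Λ y * ε) + (2 * T)⁻¹ * (2 * (A * |σ - -ε|)) := fun T hT => by
    have hrect := Complex.integral_boundary_rect_eq_zero_of_differentiableOn G
      (((-ε : ℝ) : ℂ) + ((-T : ℝ) : ℂ) * Complex.I) ((σ : ℂ) + (T : ℂ) * Complex.I) (hG.mono ?_)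
    · have e1 : (((-ε : ℝ) : ℂ) + ((-T : ℝ) : ℂ) * Complex.I).re = -ε := by simp
      have e2 : (((-ε : ℝ) : ℂ) + ((-T : ℝ) : ℂ) * Complex.I).im = -T := by simp
      have e3 : ((σ : ℂ) + (T : ℂ) * Complex.I).re = σ := by simp
      have e4 : ((σ : ℂ) + (T : ℂ) * Complex.I).im = T := by simp
      rw [e1, e2, e3, e4] at hrect
      set I1 := ∫ x : ℝ in -ε..σ, G (x + (-T : ℝ) * Complex.I)
      set I2 := ∫ x : ℝ in -ε..σ, G (x + T * Complex.I)
      set I3 := ∫ t : ℝ in -T..T, G (σ + t * Complex.I)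
      set I4 := ∫ t : ℝ in -T..T, G ((-ε : ℝ) + t * Complex.I)
      have h1 : ‖I1‖ ≤ A * |σ - -ε| :=
        intervalIntegral.norm_integral_le_of_norm_le_const (hle _)
      have h2 : ‖I2‖ ≤ A * |σ - -ε| :=
        intervalIntegral.norm_integral_le_of_norm_le_const (hle _)
      have h4 : ‖I4‖ ≤ B * Real.exp (-Λ y * ε) * (2 * T) := by
        refine (intervalIntegral.norm_integral_le_of_norm_le_const
          (C := B * Real.exp (-Λ y * ε)) fun t _ => ?_).trans (le_of_eq ?_)
        · simp only [G]
          rw [norm_mul, hnorm]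
          refine mul_le_mul (hB _ (by simp)) (le_of_eq ?_) (Real.exp_pos _).le hB0
          congr 1; simp
        · rw [abs_of_nonneg (by linarith)]; ring
      have h3 : I3 = I4 + Complex.I * (I1 - I2) := by
        have hI := Complex.I_mul_I
        simp only [smul_eq_mul] at hrect
        linear_combination (-Complex.I) * hrect + (I3 - I4) * hI
      have h5 : ‖I3‖ ≤ B * Real.exp (-Λ y * ε) * (2 * T) + 2 * (A * |σ - -ε|) := by
        rw [h3]
        refine (norm_add_le _ _).trans (add_le_add h4 ?_)
        rw [norm_mul, Complex.norm_I, one_mul]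
        linarith [norm_sub_le I1 I2]
      change ‖_ * I3‖ ≤ _
      rw [norm_mul, norm_inv, Complex.norm_real, Real.norm_of_nonneg (by positivity)]
      calc (2 * T)⁻¹ * ‖I3‖ ≤ (2 * T)⁻¹ * _ := mul_le_mul_of_nonneg_left h5 (by positivity)
        _ = _ := by field_simp
    · intro s hs
      have := hs.1
      simp only [Set.mem_preimage] at this
      rw [Set.uIcc_of_le (by simpa using hσ)] at this
      simpa using this.1
  have hlim : Tendsto (fun T : ℝ => B * Real.exp (-Λ y * ε) + (2 * T)⁻¹ * (2 * (A * |σ - -ε|)))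
      atTop (𝓝 (B * Real.exp (-Λ y * ε))) := by
    have h2 : Tendsto (fun T : ℝ => 2 * T) atTop atTop := tendsto_id.const_mul_atTop two_pos
    simpa using (h2.inv_tendsto_atTop.mul_const (2 * (A * |σ - -ε|))).const_add
      (B * Real.exp (-Λ y * ε))
  exact le_of_tendsto_of_tendsto (tendsto_mean_dirichletSeries hΛ hb hq y).norm hlim
    ((eventually_gt_atTop 0).mono key)

end

/-! ### Subexponential growth and summability over finitely generated semigroups -/

/-- By Fekete's lemma `u n ≥ L n` for the limit `L` of `u n / n`. If `L > 0`, the terms are at least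
`L / (2 n)` and the harmonic series would converge. -/
theorem Subadditive.lim_nonpos_of_summable {u : ℕ → ℝ} (hu : Subadditive u) (h0 : ∀ n, 0 ≤ u n)
    (hs : Summable fun n : ℕ+ => u n / (1 + (n : ℝ) ^ 2)) : hu.lim ≤ 0 := by
  by_contra! hL
  have hbdd : BddBelow (Set.range fun n : ℕ => u n / n) :=
    ⟨0, by rintro _ ⟨n, rfl⟩; exact div_nonneg (h0 n) n.cast_nonneg⟩
  have h1 : Summable fun n : ℕ+ => hu.lim / 2 * (1 / ((n : ℕ) : ℝ)) := by
    refine Summable.of_nonneg_of_le (fun n => by positivity) (fun n => ?_) hs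
    have hn : (1 : ℝ) ≤ ((n : ℕ) : ℝ) := by exact_mod_cast n.pos
    have h2 := hu.lim_le_div hbdd n.ne_zero
    rw [le_div_iff₀ (by linarith)] at h2
    rw [le_div_iff₀ (by positivity)]
    refine le_trans ?_ h2
    have h3 : 1 / ((n : ℕ) : ℝ) * (1 + ((n : ℕ) : ℝ) ^ 2) ≤ 2 * ((n : ℕ) : ℝ) := by
      rw [one_div, inv_mul_le_iff₀ (by linarith)]
      nlinarith
    linarith [mul_le_mul_of_nonneg_left h3 (half_pos hL).le]
  have h2 := (summable_mul_left_iff (by positivity)).mp h1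
  exact Real.not_summable_one_div_natCast
    ((summable_pnat_iff_summable_nat (f := fun n : ℕ => 1 / (n : ℝ))).mp h2)

/-- A Beurling-Domar weight grows subexponentially along powers. -/
theorem IsBeurlingDomarWeight.summable_pow_mul_exp {ω : ℕ+ × ℕ+ → ℝ} (hω : IsBeurlingDomarWeight ω)
    (x : ℕ+ × ℕ+) {c : ℝ} (hc : 0 < c) :
    Summable fun k : ℕ => ω (x ^ k) * Real.exp (-c * k) := by
  have hpos : ∀ y, 0 < ω y := fun y => one_pos.trans_le (hω.one_le y)
  let u : ℕ → ℝ := fun k => Real.log (ω (x ^ k))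
  have hu : Subadditive u := fun m n => by
    simp only [u]
    rw [← Real.log_mul (hpos _).ne' (hpos _).ne', pow_add]
    exact Real.log_le_log (hpos _) (hω.mul_le _ _)
  have h0 : ∀ n, 0 ≤ u n := fun n => Real.log_nonneg (hω.one_le _)
  have hL := hu.lim_nonpos_of_summable h0 (hω.summable_log x)
  have ht := hu.tendsto_lim ⟨0, by rintro _ ⟨n, rfl⟩; exact div_nonneg (h0 n) n.cast_nonneg⟩
  -- Eventually `ω (x ^ k) ≤ exp (c k / 2)`; half of the exponential decay remains for a geometric
  -- majorant.
  have hev := ht.eventually_lt_const (hL.trans_lt (half_pos hc))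
  have hgeo : Summable fun k : ℕ => Real.exp (k * -(c / 2)) :=
    Real.summable_exp_nat_mul_iff.mpr (by linarith)
  refine hgeo.of_norm_bounded_eventually_nat ?_
  filter_upwards [hev, Filter.eventually_gt_atTop 0] with k hk hk0
  have hk' : (0 : ℝ) < k := by exact_mod_cast hk0
  rw [div_lt_iff₀ hk'] at hk
  rw [Real.norm_of_nonneg (mul_nonneg (hpos _).le (Real.exp_pos _).le),
    ← Real.exp_log (hpos (x ^ k)), ← Real.exp_add, Real.exp_le_exp]
  simp only [u] at hk
  linarith

theorem summable_closure_of_summable_pow {M : Type*} [CommMonoid M] {F : M → ℝ} (h0 : ∀ x, 0 ≤ F x)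
    (hmul : ∀ x y, F (x * y) ≤ F x * F y) (S : Finset M)
    (hS : ∀ x ∈ S, Summable fun k : ℕ => F (x ^ k)) :
    Summable fun x : Submonoid.closure (S : Set M) => F x := by
  classical
  induction S using Finset.induction_on with
  | empty =>
    have hbot : ∀ x : Submonoid.closure ((∅ : Finset M) : Set M), (x : M) = 1 := fun x => by
      simpa using x.2
    have : Subsingleton (Submonoid.closure ((∅ : Finset M) : Set M)) :=
      ⟨fun x y => Subtype.ext ((hbot x).trans (hbot y).symm)⟩
    exact Summable.of_finite
  | insert s S _ ih =>
    have ih := ih fun x hx => hS x (Finset.mem_insert_of_mem hx)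
    have hs := hS s (Finset.mem_insert_self s S)
    -- The factorization `s ^ k * z` need not be unique. Choosing one for each element gives an
    -- injection into the pairs, whose product series dominates.
    have hsurj : ∀ x : Submonoid.closure ((insert s S : Finset M) : Set M),
        ∃ q : ℕ × Submonoid.closure (S : Set M), s ^ q.1 * (q.2 : M) = x := by
      rintro ⟨x, hx⟩
      rw [Finset.coe_insert, Set.insert_eq, Submonoid.closure_union, Submonoid.mem_sup] at hx
      obtain ⟨y, hy, z, hz, rfl⟩ := hx
      obtain ⟨k, rfl⟩ := Submonoid.mem_closure_singleton.mp hy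
      exact ⟨(k, ⟨z, hz⟩), rfl⟩
    choose g hg using hsurj
    have hinj : Function.Injective g := fun x y h => Subtype.ext (by rw [← hg x, ← hg y, h])
    have hprod := (hs.mul_of_nonneg ih (fun _ => h0 _) fun _ => h0 _).comp_injective hinj
    refine Summable.of_nonneg_of_le (fun x => h0 _) (fun x => ?_) hprod
    rw [← hg x]
    exact hmul _ _

/-! ### Restriction to a generic complex line -/

/-- The logarithm on `ℕ²` along the direction `(1, l)`. -/
noncomputable def directionalLog (l : ℝ) (x : ℕ+ × ℕ+) : ℝ :=
  Real.log (x.1 : ℕ) + l * Real.log (x.2 : ℕ)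

theorem directionalLog_mul (l : ℝ) (x y : ℕ+ × ℕ+) :
    directionalLog l (x * y) = directionalLog l x + directionalLog l y := by
  have h : ∀ n : ℕ+, ((n : ℕ) : ℝ) ≠ 0 := fun n => by exact_mod_cast n.ne_zero
  simp only [directionalLog, Prod.fst_mul, Prod.snd_mul, PNat.mul_coe, Nat.cast_mul,
    Real.log_mul (h _) (h _)]
  ring

theorem log_pnat_injective : Function.Injective fun n : ℕ+ => Real.log (n : ℕ) := fun m n h => by
  have := Real.log_injOn_pos (by simp) (by simp) h
  exact PNat.coe_injective (by exact_mod_cast this)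

/-- Each pair of points whose second coordinates differ excludes a single slope `l`, so only
countably many slopes are bad. -/
theorem exists_directionalLog_injective :
    ∃ l : ℝ, 0 < l ∧ Function.Injective (directionalLog l) := by
  let B : Set ℝ := Set.range fun p : (ℕ+ × ℕ+) × (ℕ+ × ℕ+) =>
    (Real.log (p.2.1 : ℕ) - Real.log (p.1.1 : ℕ)) / (Real.log (p.1.2 : ℕ) - Real.log (p.2.2 : ℕ))
  have hB : B.Countable := Set.countable_range _
  obtain ⟨l, hl, hlB⟩ := (hB.dense_compl ℝ).inter_open_nonempty (Set.Ioi 0) isOpen_Ioi ⟨1, Set.mem_Ioi.mpr one_pos⟩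
  refine ⟨l, hl, fun x y h => ?_⟩
  simp only [directionalLog] at h
  have h2 : x.2 = y.2 := by
    by_contra hne
    have hne' : Real.log (x.2 : ℕ) - Real.log (y.2 : ℕ) ≠ 0 :=
      sub_ne_zero.mpr fun h => hne (log_pnat_injective h)
    refine hlB ⟨(x, y), ?_⟩
    dsimp only
    rw [div_eq_iff hne']
    linarith
  refine Prod.ext (log_pnat_injective ?_) h2
  rw [h2] at h
  dsimp only
  linarith

theorem directionalLog_one (l : ℝ) : directionalLog l 1 = 0 := by
  simp [directionalLog]

theorem directionalLog_nonneg {l : ℝ} (hl : 0 < l) (x : ℕ+ × ℕ+) : 0 ≤ directionalLog l x :=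
  add_nonneg (Real.log_natCast_nonneg _) (mul_nonneg hl.le (Real.log_natCast_nonneg _))

theorem directionalLog_pow (l : ℝ) (x : ℕ+ × ℕ+) (k : ℕ) :
    directionalLog l (x ^ k) = k * directionalLog l x := by
  induction k with
  | zero => simp [directionalLog_one]
  | succ k ih => rw [pow_succ, directionalLog_mul, ih]; push_cast; ring

/-- The point `(s, l s)`. -/
def diagonalPoint {l : ℝ} (hl : 0 < l) (s : ℂ) (hs : 0 ≤ s.re) :
    ClosedRightHalfPlane × ClosedRightHalfPlane :=
  (⟨s, hs⟩, ⟨l * s, by simpa using mul_nonneg hl.le hs⟩)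

theorem dirichletMonomial_diagonalPoint {l : ℝ} (hl : 0 < l) (s : ℂ) (hs : 0 ≤ s.re)
    (x : ℕ+ × ℕ+) : dirichletMonomial x (diagonalPoint hl s hs) =
      Complex.exp (-directionalLog l x * s) := by
  have h : ∀ n : ℕ+, ((n : ℕ) : ℂ) ≠ 0 := fun n => by exact_mod_cast n.ne_zero
  simp only [dirichletMonomial, diagonalPoint, directionalLog]
  rw [Complex.cpow_def_of_ne_zero (h _), Complex.cpow_def_of_ne_zero (h _), ← Complex.exp_add,
    Complex.natCast_log.symm, Complex.natCast_log.symm]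
  congr 1
  push_cast
  ring

/-! ### Inverse powers of exponential polynomials in one variable -/

open Filter Topology in
/-- Coefficients of the powers of the inverse of a Dirichlet polynomial bounded away from zero. -/
theorem exists_coeff_inv_pow {M : Type*} [CommMonoid M] [Countable M] {Λ : M → ℝ}
    (hΛ : Function.Injective Λ) (hmul : ∀ x y, Λ (x * y) = Λ x + Λ y)
    (hnonneg : ∀ x, 0 ≤ Λ x) (S : Finset M) (a : M → ℂ) {d ε : ℝ} (hd : 0 < d) (hε : 0 ≤ ε)
    (hp : ∀ s : ℂ, -ε ≤ s.re → d ≤ ‖∑ x ∈ S, a x * Complex.exp (-Λ x * s)‖) (N : ℕ) :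
    ∃ b : M → ℂ, (∀ x, ‖b x‖ ≤ d⁻¹ ^ N * Real.exp (-Λ x * ε)) ∧ ∃ σ : ℝ, 0 ≤ σ ∧
      ∀ s : ℂ, σ ≤ s.re → HasSum (fun x => b x * Complex.exp (-Λ x * s))
        (((∑ x ∈ S, a x * Complex.exp (-Λ x * s)) ^ N)⁻¹) := by
  classical
  let p : ℂ → ℂ := fun s => ∑ x ∈ S, a x * Complex.exp (-Λ x * s)
  change ∀ s : ℂ, -ε ≤ s.re → d ≤ ‖p s‖ at hp
  have hone : Λ 1 = 0 := by simpa using hmul 1 1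
  have hpos : ∀ x, x ≠ 1 → 0 < Λ x := fun x hx =>
    (hnonneg x).lt_of_ne fun h => hx (hΛ (by rw [hone, ← h]))
  have hexp : ∀ x (s : ℂ), ‖Complex.exp (-Λ x * s)‖ = Real.exp (-Λ x * s.re) := fun x s => by
    rw [Complex.norm_exp]; simp
  have hlim : Tendsto (fun σ : ℝ => ∑ x ∈ S.erase 1, ‖a x‖ * Real.exp (-Λ x * σ)) atTop (𝓝 0) := by
    rw [← Finset.sum_const_zero (s := S.erase 1)]
    refine tendsto_finsetSum _ fun x hx => ?_
    have h1 : Tendsto (fun σ : ℝ => -Λ x * σ) atTop atBot :=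
      tendsto_id.const_mul_atTop_of_neg (by linarith [hpos x (Finset.ne_of_mem_erase hx)])
    simpa using (Real.tendsto_exp_atBot.comp h1).const_mul ‖a x‖
  -- Far to the right the nonconstant terms total less than `d / 3`. Since `|p σ| ≥ d`, the constant
  -- term `c` then exceeds them, and `1 / p` has a Neumann expansion.
  obtain ⟨σ, hσ, hσ0⟩ := ((hlim.eventually_lt_const (show (0 : ℝ) < d / 3 by positivity)).and
    (eventually_ge_atTop 0)).exists
  let D : Type := {s : ℂ // σ ≤ s.re}
  let χ : M → D → ℂ := fun x s => Complex.exp (-Λ x * (s : ℂ))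
  -- The multiplicative weight `exp (-Λ x * σ)` bounds the characters on `Re s ≥ σ`.
  let w : M → ℝ := fun x => Real.exp (-Λ x * σ)
  have hχ : IsWeightedCharacterFamily χ w := by
    refine ⟨fun s => by simp [χ, hone], fun x y s => ?_, fun x s => ?_, fun x => Real.exp_pos _,
      fun x y => le_of_eq ?_⟩
    · simp only [χ]; rw [← Complex.exp_add, hmul]; congr 1; push_cast; ring
    · simp only [χ, w]
      rw [hexp, Real.exp_le_exp]
      nlinarith [hnonneg x, s.2]
    · simp only [w]; rw [← Real.exp_add, hmul]; congr 1; ring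
  obtain ⟨c, hc⟩ : ∃ c : ℂ, ∀ s, p s = c + ∑ x ∈ S.erase 1, a x * Complex.exp (-Λ x * s) := by
    by_cases h1 : (1 : M) ∈ S
    · exact ⟨a 1, fun s => by simp only [p]; rw [← Finset.add_sum_erase S _ h1]; simp [hone]⟩
    · exact ⟨0, fun s => by simp only [p]; rw [Finset.erase_eq_of_notMem h1, zero_add]⟩
  have hc2 : 2 * (d / 3) ≤ ‖c‖ := by
    have h1 := hp (σ : ℂ) (by simp; linarith)
    rw [hc] at h1
    have h2 : ‖∑ x ∈ S.erase 1, a x * Complex.exp (-Λ x * (σ : ℂ))‖ ≤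
        ∑ x ∈ S.erase 1, ‖a x‖ * Real.exp (-Λ x * σ) :=
      (norm_sum_le _ _).trans (Finset.sum_le_sum fun x _ => by rw [norm_mul, hexp]; simp)
    linarith [norm_add_le c (∑ x ∈ S.erase 1, a x * Complex.exp (-Λ x * (σ : ℂ)))]
  have hc0 : 0 < ‖c‖ := by linarith
  have hc0' : c ≠ 0 := norm_pos_iff.mp hc0
  let R : D → ℂ := fun s => ∑ x ∈ S.erase 1, (-a x / c) * χ x s
  have hRs : HasSeriesNormLE χ w R (∑ x ∈ S.erase 1, ‖-a x / c‖ * w x) :=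
    HasSeriesNormLE.finset_sum _ _
  set r := ∑ x ∈ S.erase 1, ‖-a x / c‖ * w x with hr
  have hr1 : r < 1 := by
    have : r = (∑ x ∈ S.erase 1, ‖a x‖ * w x) / ‖c‖ := by
      rw [hr, Finset.sum_div]
      exact Finset.sum_congr rfl fun x _ => by rw [norm_div, norm_neg]; ring
    rw [this, div_lt_one hc0]
    simp only [w]
    linarith
  have hr0 : 0 ≤ r := Finset.sum_nonneg fun x _ => mul_nonneg (norm_nonneg _) (hχ.weight_pos x).le
  have hpR : ∀ s : D, p s = c * (1 - R s) := fun s => by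
    rw [hc, mul_sub, mul_one, sub_eq_add_neg, ← mul_neg]
    congr 1
    simp only [R]
    rw [← Finset.sum_neg_distrib, Finset.mul_sum]
    exact Finset.sum_congr rfl fun x _ => by simp only [χ]; field_simp
  have hcc : HasSeriesNormLE χ w (fun _ : D => c⁻¹) (‖c⁻¹‖ * w 1) := by
    have := HasSeriesNormLE.finset_sum (χ := χ) (ω := w) {1} fun _ => c⁻¹
    simpa [hχ.map_one] using this
  have hinv : HasSeriesNormLE χ w (fun s : D => (p s)⁻¹) (∑' n, r ^ n * (‖c⁻¹‖ * w 1)) := by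
    refine HasSeriesNormLE.hasSum hχ (fun n => HasSeriesNormLE.pow_mul hχ hRs hcc n)
      ((summable_geometric_of_lt_one hr0 hr1).mul_right _) fun s => ?_
    have hR1 : ‖R s‖ < 1 := (HasSeriesNormLE.norm_apply_le hχ hRs s).trans_lt hr1
    have := (hasSum_geometric_of_norm_lt_one hR1).mul_right c⁻¹
    rw [hpR, mul_inv, mul_comm]
    exact this
  obtain ⟨b, hb, -, hbs⟩ := HasSeriesNormLE.pow_mul hχ hinv (HasSeriesNormLE.one hχ) N
  have hbs' : ∀ s : ℂ, σ ≤ s.re → HasSum (fun x => b x * Complex.exp (-Λ x * s)) ((p s ^ N)⁻¹) :=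
    fun s hs => by simpa [χ] using hbs ⟨s, hs⟩
  refine ⟨b, fun x => ?_, σ, hσ0, hbs'⟩
  refine norm_dirichletSeries_coeff_le (q := fun s => (p s ^ N)⁻¹) hΛ (by linarith) hb
    (fun t => hbs' _ (by simp)) ?_ (fun s hs => ?_) x
  · refine DifferentiableOn.inv ?_ fun s hs => pow_ne_zero _ (norm_pos_iff.mp (hd.trans_le (hp s hs)))
    simp only [p]
    fun_prop
  · rw [norm_inv, norm_pow, ← inv_pow]
    gcongr
    exact hp s hs

-- For `Re s ≥ -ε`, replacing `s` by `s + ε` lands in the right half plane and changes the sum by at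
-- most `∑ ‖a x‖ (exp (Λ x ε) - 1)`, uniformly in `s`.
open Filter Topology in
theorem exists_shift_lower_bound {M : Type*} {Λ : M → ℝ} (S : Finset M) (a : M → ℂ) {d d' : ℝ}
    (hd : d' < d) (hΛ : ∀ x, 0 ≤ Λ x)
    (hp : ∀ s : ℂ, 0 ≤ s.re → d ≤ ‖∑ x ∈ S, a x * Complex.exp (-Λ x * s)‖) :
    ∃ ε : ℝ, 0 < ε ∧ ∀ s : ℂ, -ε ≤ s.re → d' ≤ ‖∑ x ∈ S, a x * Complex.exp (-Λ x * s)‖ := by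
  have hlim : Tendsto (fun ε : ℝ => ∑ x ∈ S, ‖a x‖ * (Real.exp (Λ x * ε) - 1)) (𝓝[>] 0) (𝓝 0) := by
    have : Continuous fun ε : ℝ => ∑ x ∈ S, ‖a x‖ * (Real.exp (Λ x * ε) - 1) := by fun_prop
    simpa using (this.tendsto 0).mono_left nhdsWithin_le_nhds
  obtain ⟨ε, hε, hε0⟩ := ((hlim.eventually_lt_const (sub_pos.mpr hd)).and
    self_mem_nhdsWithin).exists
  refine ⟨ε, hε0, fun s hs => ?_⟩
  have h1 := hp (s + ε) (by simp; linarith)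
  have h2 : ‖(∑ x ∈ S, a x * Complex.exp (-Λ x * (s + ε))) -
      ∑ x ∈ S, a x * Complex.exp (-Λ x * s)‖ ≤ ∑ x ∈ S, ‖a x‖ * (Real.exp (Λ x * ε) - 1) := by
    rw [← Finset.sum_sub_distrib]
    refine (norm_sum_le _ _).trans (Finset.sum_le_sum fun x _ => ?_)
    rw [← mul_sub, norm_mul]
    refine mul_le_mul_of_nonneg_left ?_ (norm_nonneg _)
    have e1 : Complex.exp (-Λ x * (s + ε)) - Complex.exp (-Λ x * s) =
        Complex.exp (-Λ x * (s + ε)) * ((1 - Real.exp (Λ x * ε) : ℝ) : ℂ) := by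
      push_cast
      rw [mul_sub, mul_one, ← Complex.exp_add]
      congr 2; ring
    have e2 : (1 : ℝ) ≤ Real.exp (Λ x * ε) :=
      Real.one_le_exp (mul_nonneg (hΛ x) (le_of_lt hε0))
    rw [e1, norm_mul, Complex.norm_real, Real.norm_of_nonpos (by linarith), Complex.norm_exp,
      neg_sub]
    refine mul_le_of_le_one_left (by linarith) (Real.exp_le_one_iff.mpr ?_)
    have : (-(Λ x : ℂ) * (s + ε)).re = -(Λ x * (s.re + ε)) := by simp
    rw [this]
    have := mul_nonneg (hΛ x) (by linarith : 0 ≤ s.re + ε)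
    linarith
  have h3 := norm_sub_norm_le (∑ x ∈ S, a x * Complex.exp (-Λ x * (s + ε)))
    (∑ x ∈ S, a x * Complex.exp (-Λ x * s))
  linarith

/-! ### Inverse powers of Dirichlet polynomials in the weighted norm -/

theorem IsWeight.isWeightedCharacterFamily {ω : ℕ+ × ℕ+ → ℝ} (hω : IsWeight ω) :
    IsWeightedCharacterFamily dirichletMonomial ω :=
  ⟨dirichletMonomial_one, dirichletMonomial_mul,
    fun x s => (norm_dirichletMonomial_le x s).trans (hω.one_le x),
    fun x => one_pos.trans_le (hω.one_le x), hω.mul_le⟩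

theorem HasSeriesNormLE.hasWeightedDirichletSeries {ω : ℕ+ × ℕ+ → ℝ}
    {f : ClosedRightHalfPlane × ClosedRightHalfPlane → ℂ} {C : ℝ}
    (hf : HasSeriesNormLE dirichletMonomial ω f C) : HasWeightedDirichletSeries ω f :=
  let ⟨a, ha, _, hs⟩ := hf
  ⟨a, ha, hs⟩

theorem HasWeightedDirichletSeries.exists_hasSeriesNormLE {ω : ℕ+ × ℕ+ → ℝ}
    {f : ClosedRightHalfPlane × ClosedRightHalfPlane → ℂ} (hf : HasWeightedDirichletSeries ω f) :
    ∃ C, HasSeriesNormLE dirichletMonomial ω f C :=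
  let ⟨a, ha, hs⟩ := hf
  ⟨_, a, ha, le_rfl, hs⟩

/-- The powers of the inverse of a Dirichlet polynomial which is bounded below have weighted norms
growing at most geometrically. -/
theorem IsBeurlingDomarWeight.exists_inv_pow {ω : ℕ+ × ℕ+ → ℝ} (hω : IsBeurlingDomarWeight ω)
    (S : Finset (ℕ+ × ℕ+)) (a : ℕ+ × ℕ+ → ℂ) {d d' : ℝ} (hd' : 0 < d') (hd : d' < d)
    (hP : ∀ s, d ≤ ‖∑ x ∈ S, a x * dirichletMonomial x s‖) :
    ∃ K : ℝ, ∀ N : ℕ, HasSeriesNormLE dirichletMonomial ω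
      (fun s => ((∑ x ∈ S, a x * dirichletMonomial x s) ^ N)⁻¹) (d'⁻¹ ^ N * K) := by
  classical
  obtain ⟨l, hl, hinj⟩ := exists_directionalLog_injective
  -- The identity is left out of the generators: its logarithm is zero, so its powers would give no
  -- exponential decay.
  let H : Submonoid (ℕ+ × ℕ+) := Submonoid.closure ((S.erase 1 : Finset (ℕ+ × ℕ+)) : Set (ℕ+ × ℕ+))
  have hSH : ∀ x ∈ S, x ∈ H := fun x hx => by
    by_cases h1 : x = 1
    · exact h1 ▸ H.one_mem
    · exact Submonoid.subset_closure (by simp [h1, hx])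
  let Λ : H → ℝ := fun x => directionalLog l x
  have hΛ : Function.Injective Λ := fun x y h => Subtype.ext (hinj h)
  have hΛ0 : ∀ x, 0 ≤ Λ x := fun x => directionalLog_nonneg hl _
  have hΛmul : ∀ x y, Λ (x * y) = Λ x + Λ y := fun x y => directionalLog_mul l _ _
  let T : Finset H := S.subtype (· ∈ H)
  have hT : ∀ F : ℕ+ × ℕ+ → ℂ, ∑ x ∈ T, F x = ∑ x ∈ S, F x := fun F =>
    Finset.sum_subtype_of_mem F hSH
  let p : ℂ → ℂ := fun s => ∑ x ∈ T, a x * Complex.exp (-Λ x * s)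
  have hp : ∀ (s : ℂ) (hs : 0 ≤ s.re),
      ∑ x ∈ S, a x * dirichletMonomial x (diagonalPoint hl s hs) = p s := fun s hs => by
    simp only [dirichletMonomial_diagonalPoint]
    exact (hT fun x => a x * Complex.exp (-directionalLog l x * s)).symm
  obtain ⟨ε, hε, hpε⟩ := exists_shift_lower_bound (Λ := Λ) T (fun x => a x) hd hΛ0
    fun s hs => (hP (diagonalPoint hl s hs)).trans_eq (congrArg _ (hp s hs))
  have hsum : Summable fun x : H => ω x * Real.exp (-Λ x * ε) := by
    refine summable_closure_of_summable_pow
      (F := fun x => ω x * Real.exp (-directionalLog l x * ε))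
      (fun x => mul_nonneg (zero_le_one.trans (hω.one_le x)) (Real.exp_pos _).le)
      (fun x y => ?_) _ fun x hx => ?_
    · rw [directionalLog_mul, neg_add, add_mul, Real.exp_add, mul_mul_mul_comm]
      exact mul_le_mul_of_nonneg_right (hω.mul_le x y) (by positivity)
    · have hx1 : 0 < directionalLog l x := (directionalLog_nonneg hl x).lt_of_ne fun h =>
        Finset.ne_of_mem_erase hx (hinj (by rw [directionalLog_one, ← h]))
      refine (hω.summable_pow_mul_exp x (mul_pos hx1 hε)).congr fun k => ?_
      rw [directionalLog_pow]
      congr 2; ring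
  refine ⟨∑' x : H, ω x * Real.exp (-Λ x * ε), fun N => ?_⟩
  let χ : H → ClosedRightHalfPlane × ClosedRightHalfPlane → ℂ := fun x => dirichletMonomial x
  let w : H → ℝ := fun x => ω x
  have hχ : IsWeightedCharacterFamily χ w := by
    have h := hω.toIsWeight.isWeightedCharacterFamily
    exact ⟨h.map_one, fun x y => h.map_mul x y, fun x => h.norm_le x, fun x => h.weight_pos x,
      fun x y => h.weight_mul_le x y⟩
  obtain ⟨b, hb, σ, hσ, hbs⟩ :=
    exists_coeff_inv_pow hΛ hΛmul hΛ0 T (fun x => a x) hd' hε.le hpε N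
  have hbw : ∀ x, ‖b x‖ * w x ≤ d'⁻¹ ^ N * (ω x * Real.exp (-Λ x * ε)) := fun x =>
    (mul_le_mul_of_nonneg_right (hb x) (hχ.weight_pos x).le).trans_eq (by simp only [w]; ring)
  have hbS : Summable fun x => ‖b x‖ * w x :=
    Summable.of_nonneg_of_le (fun x => mul_nonneg (norm_nonneg _) (hχ.weight_pos x).le) hbw
      (hsum.mul_left _)
  let Q : ClosedRightHalfPlane × ClosedRightHalfPlane → ℂ := fun s => ∑' x, b x * χ x s
  have hQs : ∀ s, HasSum (fun x => b x * χ x s) (Q s) := fun s =>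
    (Summable.of_norm_bounded hbS fun x => by
      rw [norm_mul]
      exact mul_le_mul_of_nonneg_left (hχ.norm_le x s) (norm_nonneg _)).hasSum
  have hQ : HasSeriesNormLE χ w Q (d'⁻¹ ^ N * ∑' x : H, ω x * Real.exp (-Λ x * ε)) := by
    refine ⟨b, hbS, ?_, hQs⟩
    rw [← tsum_mul_left]
    exact hbS.tsum_le_tsum hbw (hsum.mul_left _)
  have hPs : HasSeriesNormLE χ w (fun s => ∑ x ∈ S, a x * dirichletMonomial x s)
      (∑ x ∈ T, ‖a x‖ * w x) :=
    (HasSeriesNormLE.finset_sum T fun x => a x).congr fun s => hT fun x =>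
      a x * dirichletMonomial x s
  obtain ⟨c, hc, -, hcs⟩ := HasSeriesNormLE.pow_mul hχ hPs hQ N
  have hp0 : ∀ s : ℂ, 0 ≤ s.re → p s ≠ 0 := fun s hs =>
    norm_pos_iff.mp (hd'.trans_le (hpε s (by linarith)))
  have hre : ∀ t : ℝ, ((σ : ℂ) + t * Complex.I).re = σ := fun t => by simp
  have hχd : ∀ (x : H) (s : ℂ) (hs : 0 ≤ s.re), χ x (diagonalPoint hl s hs) =
      Complex.exp (-Λ x * s) := fun x s hs => dirichletMonomial_diagonalPoint hl s hs x
  -- The series of `P ^ N * Q` equals `1` on a vertical line of the diagonal, so its coefficients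
  -- are those of `1`. Hence `P ^ N * Q = 1` at every point, including those off the diagonal.
  have hc1 : c = Pi.single 1 1 := by
    refine dirichletSeries_coeff_unique (q := fun _ => 1) (σ := σ) hΛ ?_ ?_ (fun t => ?_) fun t => ?_
    · refine Summable.of_nonneg_of_le (fun x => by positivity) (fun x => ?_) hc
      refine mul_le_mul_of_nonneg_left (le_trans ?_ (hω.one_le x)) (norm_nonneg _)
      rw [Real.exp_le_one_iff, neg_mul, neg_nonpos]
      exact mul_nonneg (hΛ0 x) hσ
    · exact summable_of_ne_finset_zero (s := {1}) fun x hx => by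
        simp [Pi.single_eq_of_ne (by simpa using hx : x ≠ 1)]
    · have hs : 0 ≤ ((σ : ℂ) + t * Complex.I).re := by rw [hre]; exact hσ
      have h1 := hcs (diagonalPoint hl _ hs)
      have h2 := hQs (diagonalPoint hl _ hs)
      simp only [hχd] at h1 h2
      have h3 := h2.unique (hbs _ (hre t).ge)
      rw [Pi.mul_apply, Pi.pow_apply, h3, hp] at h1
      change HasSum _ (p _ ^ N * (p _ ^ N)⁻¹) at h1
      rwa [mul_inv_cancel₀ (pow_ne_zero _ (hp0 _ hs))] at h1
    · have := hasSum_single (f := fun x : H => (Pi.single 1 1 : H → ℂ) x *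
        Complex.exp (-Λ x * (σ + t * Complex.I))) 1 fun x hx => by simp [Pi.single_eq_of_ne hx]
      simpa [Λ, directionalLog_one] using this
  refine HasSeriesNormLE.of_injective Subtype.val_injective (hQ.congr fun s => ?_)
  have h1 := hcs s
  have h2 := hasSum_single (f := fun x : H => (Pi.single 1 1 : H → ℂ) x * χ x s) 1
    fun x hx => by simp [Pi.single_eq_of_ne hx]
  rw [hc1] at h1
  have h3 := h1.unique h2
  rw [hχ.map_one, Pi.single_eq_same, mul_one] at h3
  exact eq_inv_of_mul_eq_one_right h3

/-! ### Inversion of functions bounded away from zero -/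

theorem HasWeightedDirichletSeries.inv {ω : ℕ+ × ℕ+ → ℝ} (hω : IsBeurlingDomarWeight ω)
    {f : ClosedRightHalfPlane × ClosedRightHalfPlane → ℂ} (hf : HasWeightedDirichletSeries ω f)
    {δ : ℝ} (hδ : 0 < δ) (hfδ : ∀ s, δ ≤ ‖f s‖) :
    HasWeightedDirichletSeries ω fun s => (f s)⁻¹ := by
  classical
  have hχ := hω.toIsWeight.isWeightedCharacterFamily
  obtain ⟨a, ha, hs⟩ := hf
  have hlim : Filter.Tendsto (fun S => ∑ x ∈ S, ‖a x‖ * ω x) Filter.atTop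
      (nhds (∑' x, ‖a x‖ * ω x)) := ha.hasSum
  obtain ⟨S, hS⟩ := (hlim.eventually_const_lt
    (show ∑' x, ‖a x‖ * ω x - δ / 4 < ∑' x, ‖a x‖ * ω x by linarith)).exists
  let P : ClosedRightHalfPlane × ClosedRightHalfPlane → ℂ :=
    fun s => ∑ x ∈ S, a x * dirichletMonomial x s
  have hg : HasSeriesNormLE dirichletMonomial ω (P - f) (δ / 4) := by
    have h1 : ∀ x, ‖if x ∈ S then 0 else -a x‖ * ω x =
        ‖a x‖ * ω x - if x ∈ S then ‖a x‖ * ω x else 0 := fun x => by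
      split_ifs <;> simp
    have h2 := ha.hasSum.sub (hasSum_sum_of_ne_finset_zero (s := S)
      (f := fun x => if x ∈ S then ‖a x‖ * ω x else 0) fun x hx => by simp [hx])
    simp only [← h1] at h2
    refine ⟨fun x => if x ∈ S then 0 else -a x, h2.summable, ?_, fun s => ?_⟩
    · rw [h2.tsum_eq, Finset.sum_congr rfl fun x hx => if_pos hx]
      linarith
    · have h3 := (hasSum_sum_of_ne_finset_zero (s := S)
        (f := fun x => if x ∈ S then a x * dirichletMonomial x s else 0)
        fun x hx => by simp [hx]).sub (hs s)
      rw [Finset.sum_congr rfl fun x hx => if_pos hx] at h3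
      refine h3.congr_fun fun x => ?_
      by_cases hx : x ∈ S <;> simp [hx]
  have hPf : ∀ s, ‖(P - f) s‖ ≤ δ / 4 := HasSeriesNormLE.norm_apply_le hχ hg
  have hP : ∀ s, 3 * δ / 4 ≤ ‖P s‖ := fun s => by
    have h1 := norm_sub_norm_le (f s) (P s)
    have h2 := hPf s
    rw [Pi.sub_apply, norm_sub_rev] at h2
    linarith [hfδ s]
  -- With `δ / 2` strictly between `δ / 4` and `3 * δ / 4`, the `n`-th term has norm at most `(δ /
  -- 4) ^ n * (2 / δ) ^ (n + 1) * K`, a geometric series of ratio `1 / 2`.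
  obtain ⟨K, hK⟩ := hω.exists_inv_pow S a (half_pos hδ) (by linarith : δ / 2 < 3 * δ / 4) hP
  refine (HasSeriesNormLE.hasSum hχ
    (fun n => HasSeriesNormLE.pow_mul hχ hg (hK (n + 1)) n) ?_ fun s => ?_).hasWeightedDirichletSeries
  · refine ((summable_geometric_of_lt_one (r := 1 / 2) (by norm_num) (by norm_num)).mul_right
      ((δ / 2)⁻¹ * K)).congr fun n => ?_
    have : (1 / 2 : ℝ) = δ / 4 * (δ / 2)⁻¹ := by field_simp; norm_num
    rw [this, mul_pow, pow_succ]
    ring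
  · have hP0 : P s ≠ 0 := norm_pos_iff.mp (by linarith [hP s])
    have hlt : ‖(P - f) s / P s‖ < 1 := by
      rw [norm_div, div_lt_one (norm_pos_iff.mpr hP0)]
      linarith [hPf s, hP s]
    have h1 := (hasSum_geometric_of_norm_lt_one hlt).mul_right (P s)⁻¹
    have h2 : (1 - (P - f) s / P s)⁻¹ * (P s)⁻¹ = (f s)⁻¹ := by
      rw [← mul_inv, sub_mul, div_mul_cancel₀ _ hP0, Pi.sub_apply]
      congr 1; ring
    rw [h2] at h1
    refine h1.congr_fun fun n => ?_
    change (P - f) s ^ n * (P s ^ (n + 1))⁻¹ = _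
    rw [div_pow, pow_succ, mul_inv, div_eq_mul_inv, mul_assoc]

theorem corollary4 (ω : ℕ+ × ℕ+ → ℝ) (hω : IsBeurlingDomarWeight ω)
    (f : ClosedRightHalfPlane × ClosedRightHalfPlane → ℂ)
    (hf : HasWeightedDirichletSeries ω f) :
    IsUnit (⟨f, hf⟩ : weightedDirichletAlgebra ω hω.toIsWeight) ↔
      ∃ δ : ℝ, 0 < δ ∧ ∀ s, δ ≤ ‖f s‖ := by
  constructor
  · intro h
    obtain ⟨⟨g, hg⟩, hfg⟩ := h.exists_right_inv
    have hfg' : ∀ s, f s * g s = 1 := fun s => congrFun (congrArg Subtype.val hfg) s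
    obtain ⟨C, hC⟩ := HasWeightedDirichletSeries.exists_hasSeriesNormLE hg
    have hgC := HasSeriesNormLE.norm_apply_le hω.toIsWeight.isWeightedCharacterFamily hC
    have hg0 : ∀ s, 0 < ‖g s‖ := fun s => norm_pos_iff.mpr (right_ne_zero_of_mul_eq_one (hfg' s))
    refine ⟨C⁻¹, inv_pos.mpr ((hg0 (⟨0, le_rfl⟩, ⟨0, le_rfl⟩)).trans_le (hgC _)), fun s => ?_⟩
    rw [eq_inv_of_mul_eq_one_left (hfg' s), norm_inv]
    exact inv_anti₀ (hg0 s) (hgC s)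
  · rintro ⟨δ, hδ, h⟩
    refine IsUnit.of_mul_eq_one ⟨fun s => (f s)⁻¹, HasWeightedDirichletSeries.inv hω hf hδ h⟩ ?_
    refine Subtype.ext (funext fun s => ?_)
    exact mul_inv_cancel₀ (norm_pos_iff.mp (hδ.trans_le (h s)))
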